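/- For a permutation $\sigma=a_1a_2\cdots a_n$ of $\{1,\dots,n\}$, call $j$ the position of a record if $a_i<a_j$ for all $i<j$. Let $\mathcal{C}(n,k)$ be the number of permutations $\sigma\in\mathfrak{S}_n$ for which the sum of the positions of the records of $\sigma$ equals $k$. For $n\ge 1$ and $x\in[0,1]$ define $$\phi_n(x)=\begin{cases}\mathcal{C}(n,1) & \text{if } x<\frac{6}{n(n+1)},\\[2pt] \mathcal{C}\left(n,\frac{n(n+1)}{2}\right) & \text{if } x\ge 1-\frac{2}{n(n+1)},\\[2pt] \mathcal{C}\left(n,\left[\frac{n(n+1)}{2}x\right]\right) & \text{otherwise,}\end{cases}$$ where $[y]$ is the integer part of $y$ (where the first two cases overlap, which happens only for $n\le 2$, both values are $1$). Then $\phi_n(x)>0$ for all $n\ge1$ and $x\in[0,1]$, and the functions $x\mapsto\frac{\ln\phi_n(x)}{n\ln n}$ converge, as $n\to\infty$, uniformly on $[0,1]$ to $x\mapsto\sqrt{1-x}$, with accuracy $\mathcal{O}(1/\ln n)$: there is a constant $\widetilde{C}$ such that for all integers $n\ge 2$ $$\sup_{x\in[0,1]}\left|\frac{\ln \phi_n(x)}{n\ln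 n}-\sqrt{1-x}\right|\le\frac{\widetilde{C}}{\ln n}.$$ -/

import Mathlib

namespace RecordSum

/-- The (zero-based) index `i` is the position of a record of `σ`: every earlier entry of the word
`σ 0, σ 1, …` is smaller than `σ i`. -/
def IsRecord {n : ℕ} (σ : Equiv.Perm (Fin n)) (i : Fin n) : Prop :=
  ∀ j : Fin n, j < i → σ j < σ i

instance {n : ℕ} (σ : Equiv.Perm (Fin n)) : DecidablePred (IsRecord σ) :=
  fun i => inferInstanceAs (Decidable (∀ j : Fin n, j < i → σ j < σ i))

/-- The sum of the positions of all records of `σ`; positions are counted from `1`, so the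
index `i : Fin n` stands for the position `i + 1`. -/
def srec {n : ℕ} (σ : Equiv.Perm (Fin n)) : ℕ :=
  ∑ i : Fin n with IsRecord σ i, ((i : ℕ) + 1)

/-- `numSrec n k` is the number of permutations of length `n` for which the sum of the positions
of their records is `k`. -/
def numSrec (n k : ℕ) : ℕ :=
  Fintype.card {σ : Equiv.Perm (Fin n) // srec σ = k}

/-- The rescaled counting function on `[0, 1]`. (For `n ≥ 1` the first two conditions can hold
together only if `n ≤ 2`, and then both values are `1`; the natural-number division by `2`
is exact.) -/
noncomputable def phi (n : ℕ) (x : ℝ) : ℕ :=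
  if x < 6 / ((n : ℝ) * ((n : ℝ) + 1)) then numSrec n 1
  else if 1 - 2 / ((n : ℝ) * ((n : ℝ) + 1)) ≤ x then numSrec n (n * (n + 1) / 2)
  else numSrec n ⌊(n : ℝ) * ((n : ℝ) + 1) / 2 * x⌋₊

end RecordSum

/-! ### Recursion on the last position -/

namespace RecordSum

/-! Position `j` is a record for one choice of relative rank and a non-record for `j - 1` choices,
independently of the other positions (`numSrec_succ`). So `numSrec n k` sums, over the sets of
non-records with sum `n(n+1)/2 - k`, the products of `j - 1`. With `t = n(n+1) - 2k`, about `n²(1 -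
x)`, such a set has at most `√t` elements, which gives `2^n * n^√t` (`numSrec_le`). Conversely, the
count is at least `m!` for some `m` within `O(1)` of `√t` (`factorial_le_numSrec`). Both logarithms
equal `n log n √(1 - x)` up to `O(n)`. -/

/-- The permutation of `Fin (n + 1)` whose last value is `a` and whose other values are in the same
relative order as those of `σ`. -/
def appendLast {n : ℕ} (a : Fin (n + 1)) (σ : Equiv.Perm (Fin n)) : Equiv.Perm (Fin (n + 1)) :=
  ((finSuccEquiv' (Fin.last n)).trans (Equiv.optionCongr σ)).trans (finSuccEquiv' a).symm

@[simp] lemma appendLast_last {n : ℕ} (a : Fin (n + 1)) (σ : Equiv.Perm (Fin n)) :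
    appendLast a σ (Fin.last n) = a := by
  simp [appendLast]

@[simp] lemma appendLast_castSucc {n : ℕ} (a : Fin (n + 1)) (σ : Equiv.Perm (Fin n)) (i : Fin n) :
    appendLast a σ i.castSucc = a.succAbove (σ i) := by
  have h : finSuccEquiv' (Fin.last n) i.castSucc = some i := by
    rw [← Fin.succAbove_last]; exact finSuccEquiv'_succAbove _ _
  simp [appendLast, h]

lemma appendLast_bijective (n : ℕ) :
    Function.Bijective fun q : Fin (n + 1) × Equiv.Perm (Fin n) => appendLast q.1 q.2 := by
  rw [Fintype.bijective_iff_injective_and_card]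
  refine ⟨?_, by simp [Fintype.card_perm, Nat.factorial_succ]⟩
  rintro ⟨a, σ⟩ ⟨b, τ⟩ h
  have hab : a = b := by simpa using DFunLike.congr_fun h (Fin.last n)
  subst hab
  refine Prod.ext rfl (Equiv.ext fun i => ?_)
  simpa using DFunLike.congr_fun h i.castSucc

lemma isRecord_appendLast_castSucc {n : ℕ} (a : Fin (n + 1)) (σ : Equiv.Perm (Fin n)) (i : Fin n) :
    IsRecord (appendLast a σ) i.castSucc ↔ IsRecord σ i := by
  constructor
  · intro h j hj
    simpa using h j.castSucc (by simpa using hj)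
  · intro h j hj
    induction j using Fin.lastCases with
    | last => exact absurd hj (not_lt.2 (Fin.le_last _))
    | cast j => simpa using h j (by simpa using hj)

lemma isRecord_appendLast_last {n : ℕ} (a : Fin (n + 1)) (σ : Equiv.Perm (Fin n)) :
    IsRecord (appendLast a σ) (Fin.last n) ↔ a = Fin.last n := by
  constructor
  · intro h
    by_contra ha
    obtain ⟨j, hj⟩ : ∃ j, appendLast a σ j = Fin.last n := (appendLast a σ).surjective _
    have hne : j ≠ Fin.last n := by
      rintro rfl
      exact ha (by simpa using hj)
    have := h j (lt_of_le_of_ne (Fin.le_last _) hne)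
    rw [hj] at this
    exact absurd this (not_lt.2 (Fin.le_last _))
  · rintro rfl j hj
    induction j using Fin.lastCases with
    | last => exact absurd hj (lt_irrefl _)
    | cast j => simp [Fin.castSucc_lt_last]

lemma srec_appendLast {n : ℕ} (a : Fin (n + 1)) (σ : Equiv.Perm (Fin n)) :
    srec (appendLast a σ) = srec σ + if a = Fin.last n then n + 1 else 0 := by
  simp [srec, Finset.sum_filter, Fin.sum_univ_castSucc, isRecord_appendLast_castSucc,
    isRecord_appendLast_last]

lemma numSrec_eq_sum (n k : ℕ) :
    numSrec n k = ∑ σ : Equiv.Perm (Fin n), if srec σ = k then 1 else 0 := by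
  simp [numSrec, Fintype.card_subtype]

lemma numSrec_succ (n k : ℕ) :
    numSrec (n + 1) k = n * numSrec n k + if n + 1 ≤ k then numSrec n (k - (n + 1)) else 0 := by
  rw [numSrec_eq_sum, ← (appendLast_bijective n).sum_comp, Fintype.sum_prod_type]
  simp only [srec_appendLast]
  rw [Fin.sum_univ_castSucc]
  congr 1
  · simp [numSrec_eq_sum, Fin.castSucc_ne_last]
  · simp only [if_true]
    split_ifs with h
    · rw [numSrec_eq_sum]
      refine Finset.sum_congr rfl fun σ _ => if_congr ?_ rfl rfl
      omega
    · refine Finset.sum_eq_zero fun σ _ => if_neg ?_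
      omega

lemma numSrec_zero_zero : numSrec 0 0 = 1 := by
  simp [numSrec_eq_sum, srec]

lemma numSrec_zero_of_ne {k : ℕ} (hk : k ≠ 0) : numSrec 0 k = 0 := by
  simp [numSrec_eq_sum, srec, hk.symm]

lemma numSrec_le_factorial (n k : ℕ) : numSrec n k ≤ n.factorial := by
  refine (Fintype.card_subtype_le fun σ : Equiv.Perm (Fin n) => srec σ = k).trans_eq ?_
  rw [Fintype.card_perm, Fintype.card_fin]

/-! ### Upper bound -/

lemma numSrec_eq_zero (n : ℕ) : ∀ k, n * (n + 1) < 2 * k → numSrec n k = 0 := by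
  induction n with
  | zero => exact fun k hk => numSrec_zero_of_ne (by omega)
  | succ n ih =>
    intro k hk
    rw [numSrec_succ, ih k (by nlinarith)]
    split_ifs with h
    · rw [ih _ (by zify [h] at hk ⊢; nlinarith)]
      simp
    · simp

/-- If `(p + 1) * (p + 2)` exceeds twice the sum of the non-record positions, there are at most
`p` non-records; their set can be chosen in `2 ^ n` ways and each contributes a factor at most `B`. -/
lemma numSrec_le {B n : ℕ} (hB : 0 < B) (hn : n ≤ B) : ∀ k p, n * (n + 1) < 2 * k + (p + 1) * (p + 2) →
    numSrec n k ≤ 2 ^ n * B ^ p := by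
  induction n with
  | zero =>
    intro k p h
    rcases Nat.eq_zero_or_pos k with rfl | hk
    · rw [numSrec_zero_zero]
      exact Nat.mul_pos (by simp) (Nat.pow_pos hB)
    · rw [numSrec_zero_of_ne hk.ne']; exact Nat.zero_le _
  | succ n ih =>
    intro k p h
    -- If `n < p` the factorial bound suffices. Otherwise a non-record at `n + 1` uses up one factor
    -- `B`, and `p ≤ n` keeps the hypothesis valid for `p - 1`.
    rcases lt_or_ge n p with hp | hp
    · calc numSrec (n + 1) k ≤ (n + 1).factorial := numSrec_le_factorial _ _
        _ ≤ (n + 1) ^ (n + 1) := Nat.factorial_le_pow _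
        _ ≤ B ^ (n + 1) := Nat.pow_le_pow_left hn _
        _ ≤ B ^ p := Nat.pow_le_pow_right hB hp
        _ ≤ 2 ^ (n + 1) * B ^ p := Nat.le_mul_of_pos_left _ (by positivity)
    have h1 : n * numSrec n k ≤ 2 ^ n * B ^ p := by
      cases p with
      | zero =>
        rcases Nat.eq_zero_or_pos n with rfl | hn0
        · simp
        · rw [numSrec_eq_zero n k (by nlinarith)]; simp
      | succ p =>
        calc n * numSrec n k ≤ B * (2 ^ n * B ^ p) :=
              Nat.mul_le_mul (by omega) (ih (by omega) k p (by nlinarith))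
          _ = 2 ^ n * B ^ (p + 1) := by ring
    have h2 : (if n + 1 ≤ k then numSrec n (k - (n + 1)) else 0) ≤ 2 ^ n * B ^ p := by
      split_ifs with hk
      · refine ih (by omega) _ _ ?_
        zify [hk] at h ⊢
        nlinarith
      · exact Nat.zero_le _
    rw [numSrec_succ]
    calc _ ≤ 2 ^ n * B ^ p + 2 ^ n * B ^ p := Nat.add_le_add h1 h2
      _ = 2 ^ (n + 1) * B ^ p := by ring

/-! ### Lower bound -/

/-- The values attained by `srec` on permutations of length `n`. -/
def IsAttained (n k : ℕ) : Prop :=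
  k = 1 ∨ (3 ≤ k ∧ 2 * k + 4 ≤ n * (n + 1)) ∨ 2 * k = n * (n + 1)

/-- The non-records `2, …, m + 1` have sum `m(m+3)/2` and weight `m!`; the hypothesis says that the
non-record sum is at least this. The induction is greedy: the last position is a record whenever the
remainder is attained. -/
lemma factorial_le_numSrec (n : ℕ) (hn : 1 ≤ n) : ∀ k m, IsAttained n k →
    (m + 1) * (m + 2) + 2 * k ≤ n * (n + 1) + 2 → m.factorial ≤ numSrec n k := by
  induction n, hn using Nat.le_induction with
  | base =>
    intro k m hk h
    have hk1 : k = 1 := by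
      rcases hk with hk | hk | hk <;> omega
    subst hk1
    have hm : m = 0 := by nlinarith
    subst hm
    simp [numSrec_succ, numSrec_zero_zero]
  | succ n hn ih =>
    intro k m hk h
    rw [numSrec_succ]
    by_cases hr : n + 1 ≤ k ∧ IsAttained n (k - (n + 1))
    · rw [if_pos hr.1]
      refine (ih _ m hr.2 ?_).trans (Nat.le_add_left _ _)
      have := hr.1
      zify [this] at h ⊢
      nlinarith
    -- The greedy step fails only if `k` is too small or the remainder is `0` or `2`. Then the last
    -- position is a non-record, with factor `n ≥ m`.
    · have hsmall : k ≤ n + 1 ∨ k = n + 3 := by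
        by_contra! hc
        apply hr
        refine ⟨by omega, ?_⟩
        obtain ⟨l, rfl⟩ : ∃ l, k = n + 1 + l := ⟨k - (n + 1), by omega⟩
        rw [Nat.add_sub_cancel_left]
        rcases hk with hk | hk | hk
        · omega
        · by_cases hl : l = 1
          · exact Or.inl hl
          · exact Or.inr (Or.inl ⟨by omega, by nlinarith⟩)
        · exact Or.inr (Or.inr (by nlinarith))
      have hkpos : 1 ≤ k := by
        rcases hk with hk | hk | hk
        · omega
        · omega
        · nlinarith
      have hatt : IsAttained n k := by
        rcases Nat.lt_or_ge n 4 with hn4 | hn4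
        · unfold IsAttained at hk ⊢
          interval_cases n <;> omega
        · have h2 : 2 * (n + 3) + 4 ≤ n * (n + 1) := by nlinarith
          rcases hk with hk | hk | hk
          · exact Or.inl hk
          · exact Or.inr (Or.inl ⟨hk.1, by omega⟩)
          · have : k ≤ n + 3 := by omega
            nlinarith
      have hmn : m ≤ n := by
        by_contra! hc
        nlinarith
      refine le_trans ?_ (Nat.le_add_right _ _)
      cases m with
      | zero =>
        exact Nat.mul_pos hn (ih k 0 hatt (by
          rcases hatt with hk | hk | hk
          · nlinarith
          · omega
          · omega))
      | succ m =>
        rw [Nat.factorial_succ]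
        refine Nat.mul_le_mul hmn (ih k m hatt ?_)
        rcases Nat.lt_or_ge (m + 1) n with h1 | h1
        · obtain ⟨d, rfl⟩ : ∃ d, n = m + 2 + d := ⟨n - (m + 2), by omega⟩
          rcases hsmall with hs | rfl
          · nlinarith
          -- For `d = 0` the hypothesis `h` is contradictory; for `d > 0` there is slack.
          · rcases Nat.eq_zero_or_pos d with rfl | hd
            · nlinarith
            · nlinarith
        · obtain rfl : n = m + 1 := by omega
          nlinarith

/-! ### From `x` to an attained sum -/

lemma exists_isAttained_phi_eq {n : ℕ} (hn : 1 ≤ n) {x : ℝ} (hx : x ∈ Set.Icc (0 : ℝ) 1) :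
    ∃ k, phi n x = numSrec n k ∧ IsAttained n k ∧ (n * (n + 1) * x : ℝ) - 6 ≤ 2 * k ∧
      (2 * k : ℝ) ≤ n * (n + 1) * x + 2 := by
  have hn' : (1 : ℝ) ≤ n := by exact_mod_cast hn
  have hN : (0 : ℝ) < (n : ℝ) * (n + 1) := by positivity
  obtain ⟨hx0, hx1⟩ := hx
  have hNx : 0 ≤ (n : ℝ) * (n + 1) * x := by positivity
  unfold phi
  split_ifs with h1 h2
  · rw [lt_div_iff₀ hN] at h1
    refine ⟨1, rfl, Or.inl rfl, ?_, ?_⟩ <;> push_cast <;> linarith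
  · have h3 : 2 * (n * (n + 1) / 2) = n * (n + 1) :=
      Nat.mul_div_cancel' (Nat.even_mul_succ_self n).two_dvd
    have h4 : (2 : ℝ) * (n * (n + 1) / 2 : ℕ) = n * (n + 1) := by exact_mod_cast h3
    refine ⟨_, rfl, Or.inr (Or.inr h3), ?_, ?_⟩
    · rw [h4]; nlinarith
    · rw [h4]
      rw [sub_le_iff_le_add, ← sub_le_iff_le_add', le_div_iff₀ hN] at h2
      linarith
  · rw [not_lt, div_le_iff₀ hN] at h1
    rw [not_le, lt_sub_iff_add_lt, ← lt_sub_iff_add_lt', div_lt_iff₀ hN] at h2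
    have hfl := Nat.floor_le (a := (n : ℝ) * (n + 1) / 2 * x) (by positivity)
    have hfl' := Nat.lt_floor_add_one ((n : ℝ) * (n + 1) / 2 * x)
    refine ⟨_, rfl, Or.inr (Or.inl ⟨?_, ?_⟩), by linarith, by linarith⟩
    · exact Nat.le_floor (by push_cast; linarith)
    · have h3 : 2 * ⌊(n : ℝ) * (n + 1) / 2 * x⌋₊ + 2 < n * (n + 1) := by
        have : (2 : ℝ) * ⌊(n : ℝ) * (n + 1) / 2 * x⌋₊ + 2 < n * (n + 1) := by linarith
        exact_mod_cast this
      -- Parity improves the strict bound with `+ 2` to the required `+ 4`.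
      have := (Nat.even_mul_succ_self n).two_dvd
      omega

lemma IsAttained.two_mul_le {n k : ℕ} (hn : 1 ≤ n) (h : IsAttained n k) :
    2 * k ≤ n * (n + 1) := by
  rcases h with h | h | h
  · nlinarith
  · omega
  · omega

lemma numSrec_pos {n k : ℕ} (hn : 1 ≤ n) (h : IsAttained n k) : 0 < numSrec n k :=
  factorial_le_numSrec n hn k 0 h (by have := h.two_mul_le hn; omega)

/-! ### Logarithmic estimates and the limit -/

lemma pow_le_factorial_mul_exp (n m : ℕ) : (n : ℝ) ^ m ≤ m.factorial * Real.exp n := by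
  have := Real.pow_div_factorial_le_exp (n : ℝ) (Nat.cast_nonneg n) m
  rwa [div_le_iff₀' (by positivity)] at this

lemma mul_log_sub_le_log_factorial {n : ℕ} (hn : 1 ≤ n) (m : ℕ) :
    m * Real.log n - n ≤ Real.log m.factorial := by
  have hn' : (0 : ℝ) < n := by exact_mod_cast hn
  have h := Real.log_le_log (by positivity) (pow_le_factorial_mul_exp n m)
  rw [Real.log_pow, Real.log_mul (by positivity) (by positivity), Real.log_exp] at h
  linarith

lemma log_numSrec_ge {n k : ℕ} (hn : 1 ≤ n) (hk : IsAttained n k) {y : ℝ} (hy : 0 ≤ y)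
    (h : n ^ 2 * y ^ 2 + 2 * k ≤ (n * (n + 1) + 2 : ℝ)) :
    n * Real.log n * y - 4 * n ≤ Real.log (numSrec n k) := by
  have hn' : (1 : ℝ) ≤ n := by exact_mod_cast hn
  have h2k := hk.two_mul_le hn
  obtain ⟨t, ht⟩ : ∃ t, n * (n + 1) + 2 = 2 * k + t := ⟨n * (n + 1) + 2 - 2 * k, by omega⟩
  have htR : (n * (n + 1) + 2 : ℝ) = 2 * k + t := by exact_mod_cast ht
  have ht2 : 2 ≤ t := by omega
  -- The witness is `m = t.sqrt - 2`, truncated to `0` for small `t`; `2 ≤ t` covers that case.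
  have hle : (t.sqrt - 2 + 1) * (t.sqrt - 2 + 2) ≤ t := by
    rcases Nat.lt_or_ge t.sqrt 2 with hs | hs
    · rw [Nat.sub_eq_zero_of_le hs.le]; omega
    · calc _ ≤ t.sqrt * t.sqrt := Nat.mul_le_mul (by omega) (by omega)
        _ ≤ t := Nat.sqrt_le t
  have hlt : t < (t.sqrt - 2 + 3) * (t.sqrt - 2 + 3) :=
    (Nat.lt_succ_sqrt t).trans_le (Nat.mul_le_mul (by omega) (by omega))
  generalize t.sqrt - 2 = m at hle hlt
  have hm : n * y ≤ (m + 3 : ℝ) := by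
    have hlt' : (t : ℝ) < (m + 3) * (m + 3) := by exact_mod_cast hlt
    refine (sq_le_sq₀ (by positivity) (by positivity)).1 ?_
    rw [mul_pow]
    linarith [sq (m + 3 : ℝ)]
  have hfac : Real.log m.factorial ≤ Real.log (numSrec n k) :=
    Real.log_le_log (by positivity)
      (by exact_mod_cast factorial_le_numSrec n hn k m hk (by omega))
  have hlog0 : 0 ≤ Real.log n := Real.log_nonneg hn'
  have hlogn : Real.log n ≤ n - 1 := Real.log_le_sub_one_of_pos (by positivity)
  have := mul_log_sub_le_log_factorial hn m
  nlinarith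

lemma log_le_two_mul_sqrt {a : ℝ} (ha : 0 < a) : Real.log a ≤ 2 * √a := by
  have h := Real.log_le_sub_one_of_pos (Real.sqrt_pos.2 ha)
  rw [Real.log_sqrt ha.le] at h
  linarith

lemma log_numSrec_le {n k : ℕ} (hn : 1 ≤ n) (hk : IsAttained n k) {y : ℝ} (hy : 0 ≤ y)
    (h : (n * (n + 1) : ℝ) ≤ 2 * k + n ^ 2 * y ^ 2 + n + 6) :
    Real.log (numSrec n k) ≤ n * Real.log n * y + 6 * n := by
  have hn' : (1 : ℝ) ≤ n := by exact_mod_cast hn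
  have h2k := hk.two_mul_le hn
  obtain ⟨t, ht⟩ : ∃ t, n * (n + 1) = 2 * k + t := ⟨n * (n + 1) - 2 * k, by omega⟩
  have htR : (n * (n + 1) : ℝ) = 2 * k + t := by exact_mod_cast ht
  have hle := Nat.sqrt_le t
  have hlt : t < (t.sqrt + 1) * (t.sqrt + 1) := Nat.lt_succ_sqrt t
  generalize t.sqrt = p at hle hlt
  have hp : (p : ℝ) ≤ n * y + (√n + 3) := by
    have hle' : (p : ℝ) * p ≤ t := by exact_mod_cast hle
    have hs := Real.sq_sqrt (zero_le_one.trans hn')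
    have hs0 := Real.sqrt_nonneg (n : ℝ)
    have hny : 0 ≤ n * y := by positivity
    refine (sq_le_sq₀ (by positivity) (by positivity)).1 ?_
    nlinarith [mul_nonneg hny hs0]
  have hbound : Real.log (numSrec n k) ≤ n * Real.log 2 + p * Real.log n := by
    have h1 : (numSrec n k : ℝ) ≤ 2 ^ n * n ^ p := by
      exact_mod_cast numSrec_le hn le_rfl k p (by nlinarith)
    have h2 := Real.log_le_log (by exact_mod_cast numSrec_pos hn hk) h1
    rwa [Real.log_mul (by positivity) (by positivity), Real.log_pow, Real.log_pow] at h2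
  have hlog0 : 0 ≤ Real.log n := Real.log_nonneg hn'
  have hlogn : Real.log n ≤ n - 1 := Real.log_le_sub_one_of_pos (by positivity)
  have hlog2 : Real.log 2 ≤ 1 := by
    have := Real.log_le_sub_one_of_pos (zero_lt_two (α := ℝ)); linarith
  have hsqrt : √n * Real.log n ≤ 2 * n := by
    have := mul_le_mul_of_nonneg_left (log_le_two_mul_sqrt (a := n) (by positivity))
      (Real.sqrt_nonneg (n : ℝ))
    nlinarith [Real.mul_self_sqrt (zero_le_one.trans hn')]
  -- The error `6n` is `n` from `2^n`, `2n` from `√n log n` and `3n` from `3 log n`.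
  nlinarith [mul_le_mul_of_nonneg_right hp hlog0]

lemma abs_log_phi_sub_le {n : ℕ} (hn : 1 ≤ n) {x : ℝ} (hx : x ∈ Set.Icc (0 : ℝ) 1) :
    |Real.log (phi n x) - n * Real.log n * √(1 - x)| ≤ 6 * n := by
  obtain ⟨k, hphi, hk, hlo, hhi⟩ := exists_isAttained_phi_eq hn hx
  have hn' : (1 : ℝ) ≤ n := by exact_mod_cast hn
  have hs : √(1 - x) ^ 2 = 1 - x := Real.sq_sqrt (by linarith [hx.2])
  have hnx : 0 ≤ n * x := mul_nonneg (by positivity) hx.1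
  have hnx' : n * x ≤ n := mul_le_of_le_one_right (by positivity) hx.2
  rw [hphi, abs_le]
  have h1 := log_numSrec_ge hn hk (Real.sqrt_nonneg (1 - x)) (by rw [hs]; nlinarith)
  have h2 := log_numSrec_le hn hk (Real.sqrt_nonneg (1 - x)) (by rw [hs]; nlinarith)
  constructor <;> linarith

lemma abs_log_phi_div_sub_le {n : ℕ} (hn : 2 ≤ n) {x : ℝ} (hx : x ∈ Set.Icc (0 : ℝ) 1) :
    |Real.log (phi n x) / (n * Real.log n) - √(1 - x)| ≤ 6 / Real.log n := by
  have hn' : (1 : ℝ) < n := by exact_mod_cast hn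
  have hlog : 0 < Real.log n := Real.log_pos hn'
  have hpos : 0 < n * Real.log n := by positivity
  have h := abs_log_phi_sub_le (by omega : 1 ≤ n) hx
  have heq : Real.log (phi n x) / (n * Real.log n) - √(1 - x) =
      (Real.log (phi n x) - n * Real.log n * √(1 - x)) / (n * Real.log n) := by
    field_simp
  rw [heq, abs_div, abs_of_pos hpos, div_le_div_iff₀ hpos hlog]
  nlinarith

end RecordSum

theorem theorem2 :
    (∀ n : ℕ, 1 ≤ n → ∀ x ∈ Set.Icc (0 : ℝ) 1, 0 < RecordSum.phi n x) ∧
    TendstoUniformlyOn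
      (fun (n : ℕ) (x : ℝ) => Real.log (RecordSum.phi n x : ℝ) / ((n : ℝ) * Real.log (n : ℝ)))
      (fun x : ℝ => Real.sqrt (1 - x)) Filter.atTop (Set.Icc (0 : ℝ) 1) ∧
    ∃ C : ℝ, ∀ n : ℕ, 2 ≤ n → ∀ x ∈ Set.Icc (0 : ℝ) 1,
      |Real.log (RecordSum.phi n x : ℝ) / ((n : ℝ) * Real.log (n : ℝ)) - Real.sqrt (1 - x)|
        ≤ C / Real.log (n : ℝ) := by
  refine ⟨fun n hn x hx => ?_, ?_, 6, fun n hn x hx => RecordSum.abs_log_phi_div_sub_le hn hx⟩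
  · obtain ⟨k, hphi, hk, -⟩ := RecordSum.exists_isAttained_phi_eq hn hx
    rw [hphi]
    exact RecordSum.numSrec_pos hn hk
  · rw [Metric.tendstoUniformlyOn_iff]
    intro ε hε
    have hlim : Filter.Tendsto (fun n : ℕ => 6 / Real.log (n : ℝ)) Filter.atTop (nhds 0) :=
      (Real.tendsto_log_atTop.comp tendsto_natCast_atTop_atTop).const_div_atTop 6
    filter_upwards [hlim.eventually_lt_const hε, Filter.eventually_ge_atTop 2] with n hn h2 x hx
    rw [dist_comm, Real.dist_eq]
    exact (RecordSum.abs_log_phi_div_sub_le h2 hx).trans_lt hn
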